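/- For an integer $i\ge 2$ let $X_i$ be an alphabet with $i$ letters, $X_i^*$ the set of finite strings over it, and $|w|$ the length of $w$. A *machine* over $X_i$ is a partial computable function $T$ from $X_i^*$ to $X_i^*$ whose domain is prefix-free (no string of the domain is a proper extension of another one), and $H_{i,T}(x)=\min\{|y| : y\in X_i^*,\ T(y)=x\}\in\mathbb N\cup\{\infty\}$, with $\min\emptyset=\infty$. A machine $U$ over $X_i$ is *universal* if for every machine $T$ over $X_i$ there is a constant $k$ such that $H_{i,U}(x)\le H_{i,T}(x)+k$ for all $x\in X_i^*$. A *Gödel numbering* of $A\subseteq X_i^*$ is a computable one-to-one function $g:A\to X_2^*$; a *program* for $g$ is a program that outputs $g(u)$ on every input $u\in A$ and has no output on inputs outside $A$. **Theorem.** Let $i\ge 2$. (a) Let $U_i$ and $U_2$ be universal machines over $X_i$ and $X_2$, and write $H_i=H_{i,U_i}$ and $H_2=H_{2,U_2}$. There is a total computable function $C$ from programs to $\mathbb N$ such that for every computably enumerable set $A\subseteq X_i^*$ and every Gödel numbering $g:A\to X_2^*$: $g$ has a program, and for every program $e$ for $g$ the constant $c=C(e)$ satisfies, for all $u\in A$,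 that $H_2(g(u))$ and $H_i(u)$ are finite and $$\bigl|H_2(g(u))-\log_2(i)\cdot H_i(u)\bigr|\le c .$$ (b) The constant can be computed uniformly in the universal machines as well. Say that $(p,t)$ *presents* a universal machine $U$ over $X_j$ if $p$ is a program for the machine $U$ and $t$ is a program that, from each program of a machine $T$ over $X_j$, computes a constant $k\in\mathbb N$ with $H_{j,U}(x)\le H_{j,T}(x)+k$ for all $x\in X_j^*$. There is a partial computable function $C'$ such that, whenever $(p,t)$ presents a universal machine $U_i$ over $X_i$, $(p_2,t_2)$ presents a universal machine $U_2$ over $X_2$, and $e$ is a program for a Gödel numbering $g:A\to X_2^*$ of a computably enumerable set $A\subseteq X_i^*$, the value $c=C'(p,t,p_2,t_2,e)$ is defined and satisfies, for all $u\in A$, that $H_2(g(u))$ and $H_i(u)$ are finite and $|H_2(g(u))-\log_2(i)\cdot H_i(u)|\le c$. -/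

import Mathlib

namespace ProgramSize

open Nat.Partrec (Code)

/-- `Str i` is `X_i^*`, the finite strings over an alphabet with `i` letters. -/
abbrev Str (i : ℕ) := List (Fin i)

/-- No string of `S` is a proper extension of another string of `S`. -/
def PrefixFree {i : ℕ} (S : Set (Str i)) : Prop :=
  ∀ x z : Str i, x ∈ S → x ++ z ∈ S → z = []

/-- A self-delimiting machine: a partial computable string function whose domain is
prefix-free. -/
structure IsMachine {i : ℕ} (T : Str i →. Str i) : Prop where
  partrec : Partrec T
  prefixFree : PrefixFree T.Dom

/-- The program-size complexity of `x` relative to `T`: the least length of a `y` such that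
`T y = x`, and `⊤` if there is no such `y`. -/
noncomputable def complexity {i : ℕ} (T : Str i →. Str i) (x : Str i) : ℕ∞ :=
  ⨅ (y : Str i) (_ : x ∈ T y), (y.length : ℕ∞)

/-- A universal machine: a machine that minimizes the program-size complexity up to an
additive constant, among all machines over the same alphabet. -/
structure IsUniversal {i : ℕ} (U : Str i →. Str i) : Prop where
  isMachine : IsMachine U
  invariance : ∀ T : Str i →. Str i, IsMachine T →
    ∃ k : ℕ, ∀ x, complexity U x ≤ complexity T x + k

/-- The partial string function computed by a program `e`: Mathlib's codes for the partial
computable functions on `ℕ`, applied to encoded strings. A run that ends in a number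
encoding no string gives no output. -/
def run {i j : ℕ} (e : Code) : Str i →. Str j := fun x =>
  (e.eval (Encodable.encode x)).bind fun n => ((Encodable.decode n : Option (Str j)) : Part (Str j))

/-- `u` is a program of a universal machine, and `t` is a program that computes, from every
program `e` of a machine `T`, a constant `k` with `H_U ≤ H_T + k`. -/
structure IsEffectivelyUniversal (i : ℕ) (u t : Code) : Prop where
  isMachine : IsMachine (run u : Str i →. Str i)
  invariance : ∀ e : Code, IsMachine (run e : Str i →. Str i) →
    ∃ k ∈ t.eval (Encodable.encode e),
      ∀ x, complexity (run u : Str i →. Str i) x ≤ complexity (run e : Str i →. Str i) x + k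

/-- A Gödel numbering of `A ⊆ X_i^*`: a one-to-one function `A → X_2^*` that is computable
on `A`. -/
structure IsGodelNumbering {i : ℕ} (A : Set (Str i)) (g : A → Str 2) : Prop where
  injective : Function.Injective g
  computable : ∃ f : Str i →. Str 2, Partrec f ∧ ∀ u : A, f u = Part.some (g u)

/-- `e` is a program for `g : A → X_2^*`: on input `u ∈ A` it outputs `g u`, and it has no
output on inputs outside `A`. -/
def IsProgramFor {i : ℕ} (A : Set (Str i)) (g : A → Str 2) (e : Code) : Prop :=
  ∀ (u : Str i) (v : Str 2), v ∈ (run e : Str i →. Str 2) u ↔ ∃ h : u ∈ A, g ⟨u, h⟩ = v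

/-- `H_2(v)` relative to `U₂` and `H_i(u)` relative to `U` are finite and
`|H_2(v) - log_2(i) * H_i(u)| ≤ c`. -/
def WithinConstant {i : ℕ} (U : Str i →. Str i) (U₂ : Str 2 →. Str 2) (u : Str i) (v : Str 2)
    (c : ℕ) : Prop :=
  ∃ m n : ℕ, complexity U₂ v = m ∧ complexity U u = n ∧
    |(m : ℝ) - Real.logb 2 i * n| ≤ c

/-- Every partial computable string function is computed by a program. -/
theorem exists_run_eq {i j : ℕ} {f : Str i →. Str j} (hf : Partrec f) :
    ∃ e : Code, (run e : Str i →. Str j) = f := by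
  obtain ⟨e, he⟩ := Code.exists_code.1 hf
  refine ⟨e, ?_⟩
  funext x
  simp [run, he, Part.bind_map]

/-- Every Gödel numbering of a c.e. set has a program. -/
theorem IsGodelNumbering.exists_isProgramFor {i : ℕ} {A : Set (Str i)} {g : A → Str 2}
    (hA : REPred fun u => u ∈ A) (hg : IsGodelNumbering A g) : ∃ e, IsProgramFor A g e := by
  obtain ⟨f, hf, hfg⟩ := hg.computable
  have hp : Partrec fun u => (Part.assert (u ∈ A) fun _ => Part.some ()).bind fun _ => f u :=
    Partrec.bind hA (hf.comp Computable.fst)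
  obtain ⟨e, he⟩ := exists_run_eq hp
  refine ⟨e, fun u v => ?_⟩
  rw [he]
  by_cases h : u ∈ A
  · have := hfg ⟨u, h⟩
    simp only at this
    simp [h, this, Part.assert_pos, eq_comm]
  · simp [h, Part.assert_neg]

end ProgramSize

/-! A string over `a` letters names a subinterval of `[0, 1)`, and a prefix-free set names pairwise
disjoint ones. To rewrite a program `y` in base `b`, take a `b`-adic interval `z` inside that of
`y`, shorter only by a bounded factor (`exists_subdivides`). Its length is `|y| * log_b a + O(1)`.
Disjointness lets a search recover `y` from `z` (`Subdivides.unique`), so running the old machine on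
`y` and postprocessing its output gives a prefix-free machine over `b` letters
(`exists_transcoding`).

With `g` as postprocessing, `H_2(g u) ≤ log_2 i * H_i(u) + O(1)`. With the inverse of `g`, found by
search, `H_i(u) ≤ log_i 2 * H_2(g u) + O(1)`; multiplying by `log_2 i` gives the other half.

For fixed universal machines, one machine simulates the transcoders of all programs `e`, at the cost
of a tag whose length is computable from `e`. In the uniform version, programs of the transcoders
are computed by currying and handed to the programs for the invariance constants. -/

namespace ProgramSize

open Nat.Partrec (Code)

/-! ### Computability -/

section Search

variable {α β γ σ : Type*} [Primcodable α] [Primcodable β] [Primcodable γ] [Primcodable σ]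

/-- Dovetailing: from a partial computable `f : α → γ →. σ` one obtains a partial computable
choice, for each `a`, of a value of `f a`, which is defined if `f a` has a value at all. -/
theorem exists_partrec_search {f : α → γ →. σ} (hf : Partrec₂ f) :
    ∃ F : α →. σ, Partrec F ∧ ∀ a, (∀ v ∈ F a, ∃ c, v ∈ f a c) ∧
      ∀ c, (f a c).Dom → (F a).Dom := by
  obtain ⟨p, hp⟩ := Code.exists_code.1 hf
  have hp' : ∀ a c, p.eval (Encodable.encode (a, c)) = (f a c).map Encodable.encode := by
    intro a c
    rw [hp]
    simp
  -- Stage `n` codes a step bound and a candidate `c`.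
  let G : α → ℕ → Option σ := fun a n =>
    (Encodable.decode n.unpair.2 : Option γ).bind fun c =>
      (Code.evaln n.unpair.1 p (Encodable.encode (a, c))).bind fun m => Encodable.decode m
  have hG : Computable₂ G := by
    refine Computable.option_bind
      (Computable.decode.comp (Computable.snd.comp (Computable.unpair.comp Computable.snd))) ?_
    have hin : Computable fun x : (α × ℕ) × γ =>
        (((x.1.2.unpair.1, p), Encodable.encode (x.1.1, x.2)) : (ℕ × Code) × ℕ) :=
      ((Computable.fst.comp (Computable.unpair.comp (Computable.snd.comp Computable.fst))).pair
        (Computable.const p)).pair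
        (Computable.encode.comp ((Computable.fst.comp Computable.fst).pair Computable.snd))
    have hev := Code.primrec_evaln.to_comp.comp hin
    exact Computable.option_bind hev (Computable.decode.comp Computable.snd).to₂
  refine ⟨_, Partrec.rfindOpt hG, fun a => ⟨fun v hv => ?_, fun c hc => ?_⟩⟩
  · obtain ⟨n, hn⟩ := Nat.rfindOpt_spec hv
    simp only [G, Option.mem_def, Option.bind_eq_some_iff] at hn
    obtain ⟨c, -, m, hm, hv⟩ := hn
    have := Code.evaln_sound hm
    rw [hp', Part.mem_map_iff] at this
    obtain ⟨w, hw, rfl⟩ := this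
    rw [Encodable.encodek, Option.some_inj] at hv
    exact ⟨c, hv ▸ hw⟩
  · obtain ⟨v, hv⟩ := Part.dom_iff_mem.1 hc
    have : Encodable.encode v ∈ p.eval (Encodable.encode (a, c)) := by
      rw [hp']
      exact Part.mem_map _ hv
    obtain ⟨k, hk⟩ := Code.evaln_complete.1 this
    refine Nat.rfindOpt_dom.2 ⟨Nat.pair k (Encodable.encode c), v, ?_⟩
    simp only [G, Nat.unpair_pair, Encodable.encodek, Option.bind_some, Option.mem_def]
    rw [Option.mem_def.1 hk]
    simp

/-- The restriction of a partial computable function to a decidable set. -/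
theorem partrec_restrict {q : α → Prop} (hq : ComputablePred q) {f : α →. σ} (hf : Partrec f) :
    ∃ F : α →. σ, Partrec F ∧ ∀ a v, v ∈ F a ↔ q a ∧ v ∈ f a := by
  obtain ⟨d, hd⟩ := hq
  refine ⟨_, Partrec.cond hd hf Partrec.none, fun a v => ?_⟩
  by_cases h : q a <;> simp [h]

theorem computablePred_comp {q : β → Prop} (hq : ComputablePred q) {f : α → β}
    (hf : Computable f) : ComputablePred fun a => q (f a) :=
  let ⟨_, hd⟩ := hq
  ⟨fun a => inferInstanceAs (Decidable (q (f a))), hd.comp hf⟩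

/-- One-to-one functions of a partial computable family can be inverted uniformly. -/
theorem exists_partrec_inverse [DecidableEq σ] {h : β → γ →. σ} (hh : Partrec₂ h) :
    ∃ F : β → σ →. γ, Partrec₂ F ∧
      ∀ s x v, v ∈ h s x → (∀ x', v ∈ h s x' → x' = x) → x ∈ F s v := by
  have hrun : Partrec fun p : (β × σ) × γ => h p.1.1 p.2 :=
    hh.comp (Computable.fst.comp Computable.fst) Computable.snd
  have hq : ComputablePred fun p : ((β × σ) × γ) × σ => p.1.1.2 = p.2 :=
    (Primrec.eq.comp (Primrec.snd.comp (Primrec.fst.comp Primrec.fst))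
      Primrec.snd).computablePred
  have hx : Computable fun p : ((β × σ) × γ) × σ => p.1.2 :=
    Computable.snd.comp Computable.fst
  obtain ⟨r, hr, hrv⟩ := partrec_restrict hq hx.partrec
  -- Search over `x`: `r` returns `x` exactly when the value `w` of `h` at `x` is the target.
  have hf : Partrec₂ fun (p : β × σ) (x : γ) => (h p.1 x).bind fun w => r ((p, x), w) :=
    hrun.bind hr
  obtain ⟨F, hF, hFv⟩ := exists_partrec_search hf
  refine ⟨fun s v => F (s, v), hF, fun s x v hv hu => ?_⟩
  have hd : (F (s, v)).Dom := (hFv _).2 x (Part.dom_iff_mem.2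
    ⟨x, Part.mem_bind_iff.2 ⟨v, hv, (hrv _ _).2 ⟨rfl, Part.mem_some _⟩⟩⟩)
  obtain ⟨x', hx'⟩ := Part.dom_iff_mem.1 hd
  obtain ⟨y, hy⟩ := (hFv _).1 x' hx'
  obtain ⟨w, hw, hw'⟩ := Part.mem_bind_iff.1 hy
  obtain ⟨h1, h2⟩ := (hrv _ _).1 hw'
  simp only [PFun.coe_val, Part.mem_some_iff] at h1 h2
  subst h1 h2
  rwa [← hu _ hw]

/-- A partial computable family of string functions has programs computable from the index. -/
theorem exists_computable_run_eq {i j : ℕ} {T : β → Str i →. Str j} (hT : Partrec₂ T) :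
    ∃ p : β → Code, Computable p ∧ ∀ s, (run (p s) : Str i →. Str j) = T s := by
  obtain ⟨c, hc⟩ := Code.exists_code.1 hT
  refine ⟨fun s => Code.curry c (Encodable.encode s),
    Code.primrec₂_curry.to_comp.comp (Computable.const c) Computable.encode, fun s => ?_⟩
  funext x
  have h : Nat.pair (Encodable.encode s) (Encodable.encode x) = Encodable.encode (s, x) := rfl
  rw [run, Code.eval_curry, h, hc]
  simp [Part.bind_map]

theorem partrec_run {i j : ℕ} : Partrec₂ (run : Code → Str i →. Str j) :=
  (Code.eval_part.comp Computable.fst (Computable.encode.comp Computable.snd)).bind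
    (Computable.decode.comp Computable.snd).ofOption

theorem primrec_const_pow (b : ℕ) : Primrec fun n : ℕ => b ^ n :=
  (Primrec.nat_rec' Primrec.id (Primrec.const 1)
    (Primrec.nat_mul.comp (Primrec.snd.comp Primrec.snd) (Primrec.const b)).to₂).of_eq fun n => by
      induction n with
      | zero => rfl
      | succ n ih => simp only [id] at ih ⊢; rw [ih, pow_succ]

end Search

/-! ### Strings as intervals of numbers -/

/-- The number with the digits `x` to base `i`, most significant digit first. -/
def value {i : ℕ} (x : Str i) : ℕ := x.foldl (fun n (d : Fin i) => n * i + (d : ℕ)) 0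

theorem primrec_value {i : ℕ} : Primrec (value : Str i → ℕ) := by
  unfold value
  exact Primrec.list_foldl Primrec.id (Primrec.const 0)
    (Primrec.nat_add.comp
      (Primrec.nat_mul.comp (Primrec.fst.comp Primrec.snd) (Primrec.const i))
      (Primrec.fin_val.comp (Primrec.snd.comp Primrec.snd))).to₂

theorem value_concat {i : ℕ} (x : Str i) (d : Fin i) : value (x ++ [d]) = value x * i + d := by
  simp [value]

theorem value_lt {i : ℕ} (x : Str i) : value x < i ^ x.length := by
  induction x using List.reverseRecOn with
  | nil => simp [value]
  | append_singleton x d ih =>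
    rw [value_concat, List.length_append, List.length_singleton, pow_succ]
    nlinarith [d.isLt]

theorem value_append {i : ℕ} (x y : Str i) :
    value (x ++ y) = value x * i ^ y.length + value y := by
  induction y using List.reverseRecOn with
  | nil => simp [value]
  | append_singleton y d ih =>
    rw [← List.append_assoc, value_concat, value_concat, ih, List.length_append,
      List.length_singleton, pow_succ]
    ring

theorem value_injective {i : ℕ} {x y : Str i} (hl : x.length = y.length)
    (h : value x = value y) : x = y := by
  induction x using List.reverseRecOn generalizing y with
  | nil => simpa [eq_comm] using hl
  | append_singleton x d ih =>
    rcases List.eq_nil_or_concat y with rfl | ⟨y, e, rfl⟩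
    · simp at hl
    · rw [List.concat_eq_append] at h hl ⊢
      have hi : 0 < i := d.pos
      rw [value_concat, value_concat] at h
      have h1 := congrArg (· % i) h
      have h2 := congrArg (· / i) h
      simp only [Nat.mul_add_mod_of_lt d.isLt, Nat.mul_add_mod_of_lt e.isLt] at h1
      have hd : d = e := Fin.ext h1
      subst hd
      have h3 : value x = value y := Nat.eq_of_mul_eq_mul_right hi (by omega)
      rw [ih (by simpa using hl) h3]

theorem exists_value_eq {i : ℕ} (m k : ℕ) (h : k < i ^ m) :
    ∃ z : Str i, z.length = m ∧ value z = k := by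
  induction m generalizing k with
  | zero => exact ⟨[], rfl, by simp [value]; simpa [eq_comm] using h⟩
  | succ m ih =>
    have hi : 0 < i := Nat.pos_of_ne_zero fun h0 => by simp [h0] at h
    obtain ⟨z, hz, hk⟩ := ih (k / i) (Nat.div_lt_of_lt_mul (by rwa [pow_succ'] at h))
    refine ⟨z ++ [⟨k % i, Nat.mod_lt _ hi⟩], by simp [hz], ?_⟩
    rw [value_concat, hk]
    exact Nat.div_add_mod' k i

/-- The interval of `[0, 1)` of the numbers whose expansion to base `b` begins with `z` lies in
the interval of those whose expansion to base `a` begins with `y`, and its length is the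
largest power of `1 / b` that is at most half the length of the latter. -/
def Subdivides {a b : ℕ} (z : Str b) (y : Str a) : Prop :=
  (2 * a ^ y.length ≤ b ^ z.length ∧ b ^ z.length < 2 * a ^ y.length * b) ∧
    value y * b ^ z.length ≤ value z * a ^ y.length ∧
    (value z + 1) * a ^ y.length ≤ (value y + 1) * b ^ z.length

theorem computablePred_subdivides {a b : ℕ} :
    ComputablePred fun p : Str b × Str a => Subdivides p.1 p.2 := by
  have hz : Primrec fun p : Str b × Str a => b ^ p.1.length :=
    (primrec_const_pow b).comp (Primrec.list_length.comp Primrec.fst)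
  have hy : Primrec fun p : Str b × Str a => a ^ p.2.length :=
    (primrec_const_pow a).comp (Primrec.list_length.comp Primrec.snd)
  have hy2 : Primrec fun p : Str b × Str a => 2 * a ^ p.2.length :=
    Primrec.nat_mul.comp (Primrec.const 2) hy
  have vz : Primrec fun p : Str b × Str a => value p.1 := primrec_value.comp Primrec.fst
  have vy : Primrec fun p : Str b × Str a => value p.2 := primrec_value.comp Primrec.snd
  exact PrimrecPred.computablePred (((Primrec.nat_le.comp hy2 hz).and
    (Primrec.nat_lt.comp hz (Primrec.nat_mul.comp hy2 (Primrec.const b)))).and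
    ((Primrec.nat_le.comp (Primrec.nat_mul.comp vy hz) (Primrec.nat_mul.comp vz hy)).and
    (Primrec.nat_le.comp (Primrec.nat_mul.comp (Primrec.succ.comp vz) hy)
      (Primrec.nat_mul.comp (Primrec.succ.comp vy) hz))))

/-- A grid of mesh at most half the interval has a full cell inside it: rounding the left end up to
the grid loses less than one cell. -/
theorem exists_subdivides {a b : ℕ} (ha : 2 ≤ a) (hb : 2 ≤ b) (y : Str a) :
    ∃ z : Str b, Subdivides z y := by
  set A := a ^ y.length
  have hA : 0 < A := by positivity
  obtain ⟨m, h1, h2⟩ : ∃ m, 2 * A ≤ b ^ m ∧ b ^ m < 2 * A * b := by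
    refine ⟨Nat.clog b (2 * A), Nat.le_pow_clog hb _, ?_⟩
    have h := Nat.pow_pred_clog_lt_self hb (x := 2 * A) (by omega)
    have h0 : 0 < Nat.clog b (2 * A) := Nat.clog_pos hb (by omega)
    obtain ⟨k, hk⟩ := Nat.exists_eq_succ_of_ne_zero h0.ne'
    rw [hk] at h ⊢
    rw [pow_succ]
    exact Nat.mul_lt_mul_of_pos_right h (by omega)
  set B := b ^ m
  have hv : value y + 1 ≤ A := value_lt y
  -- the value of `z` is `value y * B / A`, rounded up
  set k := (value y * B + (A - 1)) / A
  have hk1 : value y * B + (A - 1) < (k + 1) * A := by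
    rw [mul_comm (k + 1)]; exact Nat.lt_mul_div_succ _ hA
  have hk2 : k * A ≤ value y * B + (A - 1) := Nat.div_mul_le_self _ _
  rw [add_mul, one_mul] at hk1
  have hk3 : (k + 1) * A ≤ (value y + 1) * B := by
    rw [add_mul, add_mul, one_mul, one_mul]; omega
  -- Otherwise the cell would end beyond 1, although the interval of `y` does not.
  have hkB : k < B := by
    by_contra! hlt
    have h4 : (B + 1) * A ≤ (k + 1) * A := Nat.mul_le_mul_right _ (by omega)
    have h5 : (value y + 1) * B ≤ A * B := Nat.mul_le_mul_right _ hv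
    nlinarith
  obtain ⟨z, hz, hzk⟩ := exists_value_eq m k hkB
  refine ⟨z, ?_⟩
  unfold Subdivides
  rw [hz, hzk]
  exact ⟨⟨h1, h2⟩, by change value y * B ≤ k * A; omega, hk3⟩

/-- In the summand 2, one unit pays for rounding to a power of `b`, the other for the factor `2 ≤
b`. -/
theorem Subdivides.length_le {a b : ℕ} (ha : 2 ≤ a) (hb : 2 ≤ b) {z : Str b} {y : Str a}
    (h : Subdivides z y) : (z.length : ℝ) ≤ Real.logb b a * y.length + 2 := by
  have hb1 : (1 : ℝ) < b := by exact_mod_cast hb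
  have ha0 : (0 : ℝ) < a := by positivity
  have hlt : (b : ℝ) ^ z.length ≤ a ^ y.length * (b : ℝ) ^ 2 := by
    have h2 : b ^ z.length ≤ a ^ y.length * b ^ 2 := by
      refine h.1.2.le.trans ?_
      rw [pow_two, ← mul_assoc, mul_comm 2]
      gcongr
    exact_mod_cast h2
  have := Real.logb_le_logb_of_le hb1 (by positivity) hlt
  rw [Real.logb_mul (by positivity) (by positivity), Real.logb_pow, Real.logb_pow, Real.logb_pow,
    Real.logb_self_eq_one hb1] at this
  push_cast at this
  linarith

/-- Strings whose intervals overlap are comparable. -/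
theorem exists_append_of_overlap {a : ℕ} (ha : 2 ≤ a) {y y' : Str a} (hl : y.length ≤ y'.length)
    (h : value y * a ^ y'.length < (value y' + 1) * a ^ y.length)
    (h' : value y' * a ^ y.length < (value y + 1) * a ^ y'.length) : ∃ r, y' = y ++ r := by
  -- The interval of `y'` lies in that of its prefix `t`, so the intervals of `t` and `y` overlap.
  -- Having equal length, they coincide.
  obtain ⟨t, r, rfl, ht⟩ : ∃ t r, y' = t ++ r ∧ t.length = y.length :=
    ⟨y'.take y.length, y'.drop y.length, (List.take_append_drop _ _).symm, by simpa using hl⟩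
  have hr := value_lt r
  rw [value_append, List.length_append, pow_add, ht] at h h'
  set A := a ^ y.length
  set R := a ^ r.length
  have hA : 0 < A := by positivity
  have hR : 0 < R := by positivity
  have h1 : value y < value t + 1 := by
    refine Nat.lt_of_mul_lt_mul_right (a := R * A) ?_
    calc value y * (R * A) = value y * (A * R) := by ring
      _ < (value t * R + value r + 1) * A := h
      _ ≤ (value t * R + R) * A := Nat.mul_le_mul_right _ (by omega)
      _ = (value t + 1) * (R * A) := by ring
  have h2 : value t < value y + 1 := by
    refine Nat.lt_of_mul_lt_mul_right (a := R * A) ?_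
    calc value t * (R * A) = (value t * R) * A := by ring
      _ ≤ (value t * R + value r) * A := Nat.mul_le_mul_right _ (by omega)
      _ < (value y + 1) * (A * R) := h'
      _ = (value y + 1) * (R * A) := by ring
  exact ⟨r, by rw [value_injective ht (by omega)]⟩

/-- Two elements of a prefix-free set coincide if the interval of `z` lies in that of the one,
and the interval of an extension of `z` in that of the other. -/
theorem Subdivides.unique {a b : ℕ} (ha : 2 ≤ a) (hb : 2 ≤ b) {S : Set (Str a)}
    (hS : PrefixFree S) {z w : Str b} {y y' : Str a} (hy : y ∈ S) (hy' : y' ∈ S)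
    (h : Subdivides z y) (h' : Subdivides (z ++ w) y') : y = y' := by
  obtain ⟨-, h1, h2⟩ := h
  obtain ⟨-, h1', h2'⟩ := h'
  have hb0 : 0 < b := by omega
  have hw := value_lt w
  rw [value_append, List.length_append, pow_add] at h1' h2'
  -- The nonempty interval of `z ++ w` lies in those of both `y` and `y'`, so each of these begins
  -- before the other ends.
  have key1 : value y * a ^ y'.length < (value y' + 1) * a ^ y.length := by
    set Z := b ^ z.length
    set W := b ^ w.length
    set A := a ^ y.length
    set A' := a ^ y'.length
    refine Nat.lt_of_mul_lt_mul_right (a := Z * W) ?_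
    calc value y * A' * (Z * W) = value y * Z * (A' * W) := by ring
      _ ≤ value z * A * (A' * W) := Nat.mul_le_mul_right _ h1
      _ = (value z * W) * (A * A') := by ring
      _ < (value z * W + value w + 1) * (A * A') :=
        Nat.mul_lt_mul_of_pos_right (by omega) (by positivity)
      _ = (value z * W + value w + 1) * A' * A := by ring
      _ ≤ (value y' + 1) * (Z * W) * A := Nat.mul_le_mul_right _ h2'
      _ = (value y' + 1) * A * (Z * W) := by ring
  have key2 : value y' * a ^ y.length < (value y + 1) * a ^ y'.length := by
    set Z := b ^ z.length
    set W := b ^ w.length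
    set A := a ^ y.length
    set A' := a ^ y'.length
    refine Nat.lt_of_mul_lt_mul_right (a := Z * W) ?_
    calc value y' * A * (Z * W) = value y' * (Z * W) * A := by ring
      _ ≤ (value z * W + value w) * A' * A := Nat.mul_le_mul_right _ h1'
      _ = (value z * W + value w) * (A * A') := by ring
      _ < (value z * W + W) * (A * A') :=
        Nat.mul_lt_mul_of_pos_right (by omega) (by positivity)
      _ = (value z + 1) * A * (A' * W) := by ring
      _ ≤ (value y + 1) * Z * (A' * W) := Nat.mul_le_mul_right _ h2
      _ = (value y + 1) * A' * (Z * W) := by ring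
  rcases le_total y.length y'.length with hl | hl
  · obtain ⟨r, rfl⟩ := exists_append_of_overlap ha hl key1 key2
    rw [hS y r hy hy', List.append_nil]
  · obtain ⟨r, rfl⟩ := exists_append_of_overlap ha hl key2 key1
    rw [hS y' r hy' hy, List.append_nil]

/-- The length of `z` is determined by `y`: only one power of `b` lies in `[2 * a ^ |y|, 2 * a ^ |y|
* b)`. -/
theorem Subdivides.eq_nil_of_append {a b : ℕ} (hb : 2 ≤ b) {z w : Str b} {y : Str a}
    (h : Subdivides z y) (h' : Subdivides (z ++ w) y) : w = [] := by
  by_contra hw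
  have hw' : 1 ≤ w.length := List.length_pos_iff.2 hw
  have h1 := h'.1.2
  have h2 := h.1.1
  rw [List.length_append, pow_add] at h1
  have h3 : b ≤ b ^ w.length := by
    simpa using Nat.pow_le_pow_right (n := b) (by omega) hw'
  exact absurd (Nat.mul_le_mul h2 h3) (not_le.2 h1)

/-! ### Program-size complexity -/

theorem complexity_le {i : ℕ} {T : Str i →. Str i} {x y : Str i} (h : x ∈ T y) :
    complexity T x ≤ y.length :=
  iInf₂_le y h

theorem exists_complexity_eq {i : ℕ} (T : Str i →. Str i) (x : Str i) (h : complexity T x ≠ ⊤) :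
    ∃ y, x ∈ T y ∧ complexity T x = y.length := by
  have hne : ∃ n y, x ∈ T y ∧ y.length = n := by
    by_contra! hc
    exact h (le_antisymm le_top (le_iInf₂ fun y hy => absurd rfl (hc _ y hy)))
  classical
  obtain ⟨y, hy, hl⟩ := Nat.find_spec hne
  refine ⟨y, hy, le_antisymm (complexity_le hy) (le_iInf₂ fun y' hy' => ?_)⟩
  rw [hl]
  exact_mod_cast Nat.find_min' hne ⟨y', hy', rfl⟩

/-- Compare with the machine whose only program is the empty string, with output `x`. -/
theorem IsUniversal.complexity_ne_top {i : ℕ} {U : Str i →. Str i} (hU : IsUniversal U)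
    (x : Str i) : complexity U x ≠ ⊤ := by
  have hnil : ComputablePred fun y : Str i => y = [] :=
    (Primrec.eq.comp Primrec.id (Primrec.const [])).computablePred
  obtain ⟨T, hT, hTx⟩ := partrec_restrict hnil (Computable.const x).partrec
  have hM : IsMachine T := by
    refine ⟨hT, fun y z hy hz => ?_⟩
    obtain ⟨v, hv⟩ := Part.dom_iff_mem.1 hz
    exact (List.append_eq_nil_iff.1 ((hTx _ _).1 hv).1).2
  obtain ⟨k, hk⟩ := hU.invariance T hM
  have h0 : complexity T x ≤ ([] : Str i).length :=
    complexity_le ((hTx _ _).2 ⟨rfl, Part.mem_some x⟩)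
  refine ne_top_of_le_ne_top ?_ ((hk x).trans (add_le_add_left h0 _))
  exact_mod_cast ENat.natCast_ne_top (0 + k)

theorem IsEffectivelyUniversal.isUniversal {i : ℕ} {p t : Code}
    (h : IsEffectivelyUniversal i p t) : IsUniversal (run p : Str i →. Str i) := by
  refine ⟨h.isMachine, fun T hT => ?_⟩
  obtain ⟨e, rfl⟩ := exists_run_eq hT.partrec
  obtain ⟨k, -, hk⟩ := h.invariance e hT
  exact ⟨k, hk⟩

/-! ### Machines -/

section Machines

variable {β : Type*} [Primcodable β]

/-- Machines of a computable family can be simulated by a single machine. -/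
theorem exists_isMachine_simulating {b : ℕ} (hb : 2 ≤ b) {T : β → Str b →. Str b}
    (hT : Partrec₂ T) (hpf : ∀ s, PrefixFree (T s).Dom) :
    ∃ J : Str b →. Str b, IsMachine J ∧
      ∀ s v, complexity J v ≤ complexity (T s) v + (Encodable.encode s + 1 : ℕ) := by
  let c : Fin b := ⟨0, by omega⟩
  let d : Fin b := ⟨1, by omega⟩
  have hcd : c ≠ d := by simp [c, d]
  -- Unary codewords `c…cd` form a prefix-free code, so an input splits in at most one way into a
  -- tag and a program.
  let tag : β → Str b := fun s => Nat.rec [d] (fun _ l => c :: l) (Encodable.encode s)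
  have htag : Computable tag :=
    (Primrec.nat_rec' Primrec.encode (Primrec.const [d])
      (Primrec.list_cons.comp (Primrec.const c) (Primrec.snd.comp Primrec.snd)).to₂).to_comp
  have hlen : ∀ s, (tag s).length = Encodable.encode s + 1 := by
    intro s
    simp only [tag]
    induction Encodable.encode s with
    | zero => rfl
    | succ n ih => simp [ih]
  have hinj : ∀ s s' z z', tag s ++ z = tag s' ++ z' → s = s' ∧ z = z' := by
    intro s s' z z'
    suffices h : ∀ m n : ℕ, (Nat.rec [d] (fun _ l => c :: l) m : Str b) ++ z =
        (Nat.rec [d] (fun _ l => c :: l) n : Str b) ++ z' → m = n ∧ z = z' by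
      intro h0
      obtain ⟨h1, h2⟩ := h _ _ h0
      exact ⟨Encodable.encode_injective h1, h2⟩
    intro m
    induction m with
    | zero => rintro (_ | n) <;> simp [hcd.symm]
    | succ m ih =>
      rintro (_ | n) h
      · simp [hcd] at h
      · simpa using ih n (List.cons.inj h).2
  have hq : ComputablePred fun p : Str b × (β × Str b) => p.1 = tag p.2.1 ++ p.2.2 := by
    classical
    exact ((Primrec.eq (α := Str b)).decide.to_comp.comp Computable.fst
      (Computable.list_append.comp (htag.comp (Computable.fst.comp Computable.snd))
        (Computable.snd.comp Computable.snd))).computablePred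
  obtain ⟨f, hf, hfv⟩ := partrec_restrict hq
    (hT.comp (Computable.fst.comp Computable.snd) (Computable.snd.comp Computable.snd))
  obtain ⟨J, hJ, hJv⟩ := exists_partrec_search (f := fun w p => f (w, p)) hf
  have hmem : ∀ w v, v ∈ J w → ∃ s z, w = tag s ++ z ∧ v ∈ T s z := by
    intro w v hv
    obtain ⟨⟨s, z⟩, h⟩ := (hJv w).1 v hv
    exact ⟨s, z, (hfv _ _).1 h⟩
  refine ⟨J, ⟨hJ, fun w r hw hr => ?_⟩, fun s v => ?_⟩
  · obtain ⟨v, hv⟩ := Part.dom_iff_mem.1 hw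
    obtain ⟨v', hv'⟩ := Part.dom_iff_mem.1 hr
    obtain ⟨s, z, rfl, h⟩ := hmem _ _ hv
    obtain ⟨s', z', h1, h'⟩ := hmem _ _ hv'
    rw [List.append_assoc] at h1
    obtain ⟨rfl, rfl⟩ := hinj _ _ _ _ h1
    exact hpf s z r (Part.dom_iff_mem.2 ⟨v, h⟩) (Part.dom_iff_mem.2 ⟨v', h'⟩)
  · by_cases htop : complexity (T s) v = ⊤
    · simp [htop]
    obtain ⟨z, hz, hc⟩ := exists_complexity_eq _ _ htop
    have hd : (J (tag s ++ z)).Dom :=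
      (hJv _).2 (s, z) (Part.dom_iff_mem.2 ⟨v, (hfv _ _).2 ⟨rfl, hz⟩⟩)
    obtain ⟨v', hv'⟩ := Part.dom_iff_mem.1 hd
    obtain ⟨s', z', h1, h'⟩ := hmem _ _ hv'
    obtain ⟨rfl, rfl⟩ := hinj _ _ _ _ h1
    rw [Part.mem_unique h' hz] at hv'
    refine (complexity_le hv').trans ?_
    rw [hc, List.length_append, hlen]
    exact_mod_cast (add_comm _ _).le

/-- From a machine over `a` letters one obtains a machine over `b` letters, whose programs are
longer by the factor `log_b a` and output the images of the outputs under a partial computable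
function. -/
theorem exists_transcoding {a b : ℕ} (ha : 2 ≤ a) (hb : 2 ≤ b) {U : β → Str a →. Str a}
    {h : β → Str a →. Str b} (hU : Partrec₂ U) (hh : Partrec₂ h) :
    ∃ T : β → Str b →. Str b, Partrec₂ T ∧ ∀ s, PrefixFree (U s).Dom →
      PrefixFree (T s).Dom ∧ ∀ y x v, x ∈ U s y → v ∈ h s x →
        ∃ n : ℕ, complexity (T s) v ≤ n ∧ (n : ℝ) ≤ Real.logb b a * y.length + 2 := by
  have hq : ComputablePred fun p : (β × Str b) × Str a => Subdivides p.1.2 p.2 :=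
    computablePred_comp computablePred_subdivides
      ((Computable.snd.comp Computable.fst).pair Computable.snd)
  have hUh : Partrec fun p : (β × Str b) × Str a => (U p.1.1 p.2).bind fun x => h p.1.1 x :=
    (hU.comp (Computable.fst.comp Computable.fst) Computable.snd).bind
      (hh.comp (Computable.fst.comp (Computable.fst.comp Computable.fst)) Computable.snd).to₂
  obtain ⟨f, hf, hfv⟩ := partrec_restrict hq hUh
  obtain ⟨F, hF, hFv⟩ := exists_partrec_search (f := fun p y => f (p, y)) hf
  have hmem : ∀ s z v, v ∈ F (s, z) → ∃ y, Subdivides z y ∧ ∃ x ∈ U s y, v ∈ h s x := by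
    intro s z v hv
    obtain ⟨y, hy⟩ := (hFv _).1 v hv
    obtain ⟨h1, h2⟩ := (hfv _ _).1 hy
    exact ⟨y, h1, Part.mem_bind_iff.1 h2⟩
  refine ⟨fun s z => F (s, z), hF, fun s hs => ⟨fun z r hz hr => ?_, fun y x v hx hv => ?_⟩⟩
  · obtain ⟨v, hv⟩ := Part.dom_iff_mem.1 hz
    obtain ⟨v', hv'⟩ := Part.dom_iff_mem.1 hr
    obtain ⟨y, h1, x, hx, -⟩ := hmem _ _ _ hv
    obtain ⟨y', h2, x', hx', -⟩ := hmem _ _ _ hv'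
    obtain rfl := h1.unique ha hb hs (Part.dom_iff_mem.2 ⟨x, hx⟩)
      (Part.dom_iff_mem.2 ⟨x', hx'⟩) h2
    exact h1.eq_nil_of_append hb h2
  · obtain ⟨z, hz⟩ := exists_subdivides ha hb y
    have hd : (F (s, z)).Dom := (hFv _).2 y
      (Part.dom_iff_mem.2 ⟨v, (hfv _ _).2 ⟨hz, Part.mem_bind_iff.2 ⟨x, hx, hv⟩⟩⟩)
    obtain ⟨v', hv'⟩ := Part.dom_iff_mem.1 hd
    obtain ⟨y', h2, x', hx', hv2⟩ := hmem _ _ _ hv'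
    -- The search may have stopped at some other `y'`; as `z` subdivides both, `y' = y`.
    obtain rfl := hz.unique (w := []) ha hb hs (Part.dom_iff_mem.2 ⟨x, hx⟩)
      (Part.dom_iff_mem.2 ⟨x', hx'⟩) (by rwa [List.append_nil])
    obtain rfl := Part.mem_unique hx hx'
    obtain rfl := Part.mem_unique hv hv2
    exact ⟨z.length, complexity_le hv', hz.length_le ha hb⟩

end Machines

/-! ### Comparison of the two complexities -/

theorem withinConstant_of_le {i : ℕ} (hi : 2 ≤ i) {U : Str i →. Str i} {U₂ : Str 2 →. Str 2}
    (hU : IsUniversal U) (hU₂ : IsUniversal U₂) {u : Str i} {v : Str 2} {k k₂ : ℕ}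
    (h₂ : ∀ y, u ∈ U y → ∃ n : ℕ, complexity U₂ v ≤ n + k₂ ∧
      (n : ℝ) ≤ Real.logb (2 : ℕ) i * y.length + 2)
    (h : ∀ y, v ∈ U₂ y → ∃ n : ℕ, complexity U u ≤ n + k ∧
      (n : ℝ) ≤ Real.logb i (2 : ℕ) * y.length + 2) :
    WithinConstant U U₂ u v (k₂ + 2 + i * (k + 2)) := by
  obtain ⟨y, hy, hc⟩ := exists_complexity_eq U u (hU.complexity_ne_top u)
  obtain ⟨y₂, hy₂, hc₂⟩ := exists_complexity_eq U₂ v (hU₂.complexity_ne_top v)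
  refine ⟨_, _, hc₂, hc, ?_⟩
  obtain ⟨n₂, hn₂, hb₂⟩ := h₂ y hy
  obtain ⟨n, hn, hb⟩ := h y₂ hy₂
  rw [hc₂] at hn₂
  rw [hc] at hn
  have e₂ : (y₂.length : ℝ) ≤ n₂ + k₂ := by exact_mod_cast hn₂
  have e : (y.length : ℝ) ≤ n + k := by exact_mod_cast hn
  have hi' : (2 : ℝ) ≤ i := by exact_mod_cast hi
  have hlog : 0 < Real.logb 2 i := Real.logb_pos (by norm_num) (by linarith)
  -- Multiplying the second bound by `log_2 i` scales its error `k + 2`; replacing the factor by `i`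
  -- keeps the constant a natural number.
  have hlog_le : Real.logb 2 i ≤ i := by
    rw [Real.logb_le_iff_le_rpow (by norm_num) (by linarith), Real.rpow_natCast]
    exact_mod_cast Nat.lt_two_pow_self.le
  have hinv : Real.logb i (2 : ℕ) = (Real.logb 2 i)⁻¹ := by
    rw [Real.inv_logb]; norm_num
  rw [hinv] at hb
  push_cast at hb₂
  have hmul : Real.logb 2 i * y.length ≤ y₂.length + Real.logb 2 i * (k + 2) := by
    calc Real.logb 2 i * y.length
        ≤ Real.logb 2 i * ((Real.logb 2 i)⁻¹ * y₂.length + 2 + k) := by gcongr; linarith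
      _ = y₂.length + Real.logb 2 i * (k + 2) := by field_simp; ring
  have hle : Real.logb 2 i * (k + 2) ≤ i * (k + 2 : ℝ) := by gcongr
  have hpos : (0 : ℝ) ≤ i * (k + 2 : ℝ) := by positivity
  have hk : (0 : ℝ) ≤ k₂ := by positivity
  push_cast
  rw [abs_le]
  constructor <;> linarith

theorem IsProgramFor.mem_run {i : ℕ} {A : Set (Str i)} {g : A → Str 2} {e : Code}
    (he : IsProgramFor A g e) (u : A) : g u ∈ (run e : Str i →. Str 2) u :=
  (he _ _).2 ⟨u.2, rfl⟩

/-- Since `e` has no output outside `A`, injectivity on `A` suffices for inverting `run e` at `g u`.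
-/
theorem IsProgramFor.eq_of_mem_run {i : ℕ} {A : Set (Str i)} {g : A → Str 2} {e : Code}
    (he : IsProgramFor A g e) (hg : IsGodelNumbering A g) (u : A) (u' : Str i)
    (h : g u ∈ (run e : Str i →. Str 2) u') : u' = u := by
  obtain ⟨hu', h'⟩ := (he _ _).1 h
  exact congrArg Subtype.val (hg.injective h')

/-- The two machines by which the complexities of `u` and `g u` are compared, for families of
machines `U` over `X_i` and `U₂` over `X_2` and of programs `q` of Gödel numberings. -/
theorem exists_machines {β : Type*} [Primcodable β] {i : ℕ} (hi : 2 ≤ i)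
    {U : β → Str i →. Str i} {U₂ : β → Str 2 →. Str 2} (hU : Partrec₂ U) (hU₂ : Partrec₂ U₂)
    {q : β → Code} (hq : Computable q) :
    ∃ (T : β → Str i →. Str i) (T₂ : β → Str 2 →. Str 2), Partrec₂ T ∧ Partrec₂ T₂ ∧
      (∀ s, PrefixFree (U₂ s).Dom → PrefixFree (T s).Dom) ∧
      (∀ s, PrefixFree (U s).Dom → PrefixFree (T₂ s).Dom) ∧
      ∀ s, IsUniversal (U s) → IsUniversal (U₂ s) →
        ∀ (A : Set (Str i)) (g : A → Str 2), IsGodelNumbering A g → IsProgramFor A g (q s) →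
        ∀ k k₂ : ℕ, (∀ x, complexity (U s) x ≤ complexity (T s) x + k) →
          (∀ x, complexity (U₂ s) x ≤ complexity (T₂ s) x + k₂) →
          ∀ u : A, WithinConstant (U s) (U₂ s) u (g u) (k₂ + 2 + i * (k + 2)) := by
  have hrun : Partrec₂ fun s => (run (q s) : Str i →. Str 2) :=
    partrec_run.comp (hq.comp Computable.fst) Computable.snd
  obtain ⟨F, hF, hFv⟩ := exists_partrec_inverse hrun
  -- `T₂` decodes programs of `U` and applies `g`; `T` decodes programs of `U₂` and inverts `g`.
  obtain ⟨T₂, hT₂, hT₂v⟩ := exists_transcoding hi le_rfl hU hrun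
  obtain ⟨T, hT, hTv⟩ := exists_transcoding le_rfl hi hU₂ hF
  refine ⟨T, T₂, hT, hT₂, fun s hs => (hTv s hs).1, fun s hs => (hT₂v s hs).1, ?_⟩
  intro s hs hs₂ A g hg he k k₂ hk hk₂ u
  refine withinConstant_of_le hi hs hs₂ (fun y hy => ?_) (fun y hy => ?_)
  · obtain ⟨n, hn, hb⟩ := (hT₂v s hs.isMachine.prefixFree).2 y u (g u) hy (he.mem_run u)
    exact ⟨n, (hk₂ _).trans (by gcongr), hb⟩
  · obtain ⟨n, hn, hb⟩ := (hTv s hs₂.isMachine.prefixFree).2 y (g u) u hy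
      (hFv s u (g u) (he.mem_run u) (he.eq_of_mem_run hg u))
    exact ⟨n, (hk _).trans (by gcongr), hb⟩

/-- The transcoders are prefix-free for every code `e`, whether or not it is a program of a Gödel
numbering, so `J` and `J₂` can simulate them all. Their invariance constants do not depend on `e`,
which enters only through the tag length; hence `C` is total. -/
theorem exists_computable_constant {i : ℕ} (hi : 2 ≤ i) {U : Str i →. Str i}
    {U₂ : Str 2 →. Str 2} (hU : IsUniversal U) (hU₂ : IsUniversal U₂) :
    ∃ C : Code → ℕ, Computable C ∧ ∀ (A : Set (Str i)) (g : A → Str 2), IsGodelNumbering A g →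
      ∀ e, IsProgramFor A g e → ∀ u : A, WithinConstant U U₂ u (g u) (C e) := by
  obtain ⟨T, T₂, hT, hT₂, hpf, hpf₂, hc⟩ := exists_machines hi
    (U := fun _ : Code => U) (U₂ := fun _ : Code => U₂) (hU.isMachine.partrec.comp Computable.snd)
    (hU₂.isMachine.partrec.comp Computable.snd) Computable.id
  obtain ⟨J, hJ, hJT⟩ := exists_isMachine_simulating hi hT
    fun s => hpf s hU₂.isMachine.prefixFree
  obtain ⟨J₂, hJ₂, hJT₂⟩ := exists_isMachine_simulating le_rfl hT₂
    fun s => hpf₂ s hU.isMachine.prefixFree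
  obtain ⟨k, hk⟩ := hU.invariance J hJ
  obtain ⟨k₂, hk₂⟩ := hU₂.invariance J₂ hJ₂
  refine ⟨fun e => (Encodable.encode e + 1 + k₂) + 2 + i * ((Encodable.encode e + 1 + k) + 2),
    ?_, fun A g hg e he => ?_⟩
  · have h (m : ℕ) : Primrec fun e : Code => Encodable.encode e + 1 + m + 2 :=
      Primrec.nat_add.comp (Primrec.nat_add.comp (Primrec.succ.comp Primrec.encode)
        (Primrec.const m)) (Primrec.const 2)
    exact (Primrec.nat_add.comp (h k₂) (Primrec.nat_mul.comp (Primrec.const i) (h k))).to_comp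
  · refine hc e hU hU₂ A g hg he _ _ (fun x => (hk x).trans ?_) (fun x => (hk₂ x).trans ?_)
    · rw [Nat.cast_add, ← add_assoc]
      exact add_le_add_left (hJT e x) _
    · rw [Nat.cast_add, ← add_assoc]
      exact add_le_add_left (hJT₂ e x) _

/-- Arbitrary codes `p`, `p₂` need not compute machines, so a joint simulation of all transcoders
need not be prefix-free. Instead `t` and `t₂` are run on programs of the individual transcoders, and
only valid presentations guarantee that they halt. -/
theorem exists_partrec_constant {i : ℕ} (hi : 2 ≤ i) :
    ∃ C : (Code × Code) × (Code × Code) × Code →. ℕ, Partrec C ∧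
      ∀ p p₂ t t₂ : Code, IsEffectivelyUniversal i p t → IsEffectivelyUniversal 2 p₂ t₂ →
      ∀ (A : Set (Str i)) (g : A → Str 2), IsGodelNumbering A g → ∀ e, IsProgramFor A g e →
        ∃ c ∈ C ((p, t), (p₂, t₂), e), ∀ u : A,
          WithinConstant (i := i) (run p) (run p₂) u (g u) c := by
  obtain ⟨T, T₂, hT, hT₂, hpf, hpf₂, hc⟩ := exists_machines hi
    (U := fun s : (Code × Code) × Code => run s.1.1) (U₂ := fun s => run s.1.2) (q := Prod.snd)
    (partrec_run.comp (Computable.fst.comp (Computable.fst.comp Computable.fst)) Computable.snd)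
    (partrec_run.comp (Computable.snd.comp (Computable.fst.comp Computable.fst)) Computable.snd)
    Computable.snd
  obtain ⟨r, hr, hrT⟩ := exists_computable_run_eq hT
  obtain ⟨r₂, hr₂, hrT₂⟩ := exists_computable_run_eq hT₂
  have hs : Computable fun x : (Code × Code) × (Code × Code) × Code =>
      ((x.1.1, x.2.1.1), x.2.2) :=
    ((Computable.fst.comp Computable.fst).pair
      (Computable.fst.comp (Computable.fst.comp Computable.snd))).pair
      (Computable.snd.comp Computable.snd)
  have hk : Partrec fun x : (Code × Code) × (Code × Code) × Code =>
      x.1.2.eval (Encodable.encode (r ((x.1.1, x.2.1.1), x.2.2))) :=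
    Code.eval_part.comp (Computable.snd.comp Computable.fst)
      (Computable.encode.comp (hr.comp hs))
  have hk₂ : Partrec fun x : (Code × Code) × (Code × Code) × Code =>
      x.2.1.2.eval (Encodable.encode (r₂ ((x.1.1, x.2.1.1), x.2.2))) :=
    Code.eval_part.comp (Computable.snd.comp (Computable.fst.comp Computable.snd))
      (Computable.encode.comp (hr₂.comp hs))
  have hsum : Primrec₂ fun k k₂ : ℕ => k₂ + 2 + i * (k + 2) :=
    Primrec.nat_add.comp (Primrec.nat_add.comp Primrec.snd (Primrec.const 2))
      (Primrec.nat_mul.comp (Primrec.const i)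
        (Primrec.nat_add.comp Primrec.fst (Primrec.const 2)))
  refine ⟨_, hk.bind ((hk₂.comp Computable.fst).map (hsum.to_comp.comp
    (Computable.snd.comp Computable.fst) Computable.snd).to₂).to₂, ?_⟩
  intro p p₂ t t₂ hp hp₂ A g hg e he
  obtain ⟨k, hkt, hk⟩ := hp.invariance (r ((p, p₂), e))
    ⟨by rw [hrT]; exact hT.comp (Computable.const _) Computable.id,
      by rw [hrT]; exact hpf _ hp₂.isMachine.prefixFree⟩
  obtain ⟨k₂, hkt₂, hk₂⟩ := hp₂.invariance (r₂ ((p, p₂), e))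
    ⟨by rw [hrT₂]; exact hT₂.comp (Computable.const _) Computable.id,
      by rw [hrT₂]; exact hpf₂ _ hp.isMachine.prefixFree⟩
  rw [hrT] at hk
  rw [hrT₂] at hk₂
  exact ⟨_, Part.mem_bind hkt (Part.mem_map _ hkt₂),
    hc ((p, p₂), e) hp.isUniversal hp₂.isUniversal A g hg he k k₂ hk hk₂⟩

end ProgramSize

theorem mainTheorem7 (i : ℕ) (hi : 2 ≤ i) :
    -- for fixed universal machines, a constant is computable from a program of `g`
    (∀ (U : ProgramSize.Str i →. ProgramSize.Str i) (U₂ : ProgramSize.Str 2 →. ProgramSize.Str 2),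
      ProgramSize.IsUniversal U → ProgramSize.IsUniversal U₂ →
      ∃ C : Nat.Partrec.Code → ℕ, Computable C ∧
        ∀ (A : Set (ProgramSize.Str i)) (g : A → ProgramSize.Str 2),
          REPred (fun u => u ∈ A) → ProgramSize.IsGodelNumbering A g →
          (∃ e, ProgramSize.IsProgramFor A g e) ∧
          ∀ e, ProgramSize.IsProgramFor A g e →
            ∀ u : A, ProgramSize.WithinConstant U U₂ u (g u) (C e)) ∧
    -- a constant is also computable, by one algorithm, from programs of `U_i`, `U_2` and `g`
    -- and the programs giving the invariance constants of `U_i` and `U_2`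
    (∃ C : (Nat.Partrec.Code × Nat.Partrec.Code) × (Nat.Partrec.Code × Nat.Partrec.Code) ×
        Nat.Partrec.Code →. ℕ, Partrec C ∧
      ∀ p p₂ t t₂ : Nat.Partrec.Code,
        ProgramSize.IsEffectivelyUniversal i p t → ProgramSize.IsEffectivelyUniversal 2 p₂ t₂ →
        ∀ (A : Set (ProgramSize.Str i)) (g : A → ProgramSize.Str 2),
          REPred (fun u => u ∈ A) → ProgramSize.IsGodelNumbering A g →
          ∀ e, ProgramSize.IsProgramFor A g e →
            ∃ c ∈ C ((p, t), (p₂, t₂), e), ∀ u : A,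
              ProgramSize.WithinConstant (i := i) (ProgramSize.run p) (ProgramSize.run p₂) u (g u) c) := by
  refine ⟨fun U U₂ hU hU₂ => ?_, ?_⟩
  · obtain ⟨C, hC, h⟩ := ProgramSize.exists_computable_constant hi hU hU₂
    exact ⟨C, hC, fun A g hA hg => ⟨hg.exists_isProgramFor hA, h A g hg⟩⟩
  · obtain ⟨C, hC, h⟩ := ProgramSize.exists_partrec_constant hi
    exact ⟨C, hC, fun p p₂ t t₂ hp hp₂ A g _ hg => h p p₂ t t₂ hp hp₂ A g hg⟩
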